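/- A DG ring is a unital associative ring graded by $\mathbb{Z}$, with a differential $d$ of degree $1$ satisfying $d \circ d = 0$ and the graded Leibniz rule; the zero ring is allowed, and $\mathrm{DGRng}$ is the category of DG rings and (unital, degree $0$) DG ring homomorphisms. For a simplicial set $X$, let $\mathrm{N}(X,\mathbb{Z})$ be the DG ring $\bigoplus_{p\ge 0}\mathrm{N}^p(X,\mathbb{Z})$, where $\mathrm{N}^p(X,\mathbb{Z})$ is the group of functions $X_p \to \mathbb{Z}$ that vanish on the images of all degeneracy maps $X_{p-1}\to X_p$, with differential $\sum_i (-1)^i \partial^i$ and the Alexander–Whitney multiplication $(b * c)(x) = b(x|_{(0,\dots,p)})\, c(x|_{(p,\dots,p+q)})$ for $b$ of degree $p$, $c$ of degree $q$ and $x \in X_{p+q}$. For a DG ring $B$ put $\mathrm{N}(X,B) := \mathrm{N}(X,\mathbb{Z}) \otimes_{\mathbb{Z}} B$; this is contravariantly functorial in $X$. The simplicial cylinder DG ring of $B$ is $\mathrm{Cyl}(B) = \{\mathrm{Cyl}_q(B)\}_{q \in \mathbb{N}}$ with $\mathrm{Cyl}_q(B) := \mathrm{N}(\Delta^q, B)$,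 so that for every DG ring $A$ there is a simplicial set $\mathrm{Hom}_{\mathrm{DGRng}}(A, \mathrm{Cyl}(B)) = \{\mathrm{Hom}_{\mathrm{DGRng}}(A, \mathrm{Cyl}_q(B))\}_{q\in\mathbb{N}}$. For $0 \le i \le q$, the horn $\Lambda^q_i \subseteq \Delta^q$ is the simplicial subset of the simplices $s : [p] \to [q]$ with $s([p]) \cup \{i\} \ne [q]$. **Theorem.** Let $A$ and $B$ be DG rings, and let $\Lambda^q_i$ be a horn in $\Delta^q$, where $q \in \mathbb{N}$ and $0 \le i \le q$. Then there is a canonical bijection $$ \mathrm{Hom}_{\mathrm{SSet}}\bigl(\Lambda^q_i,\ \mathrm{Hom}_{\mathrm{DGRng}}(A, \mathrm{Cyl}(B))\bigr) \;\cong\; \mathrm{Hom}_{\mathrm{DGRng}}\bigl(A, \mathrm{N}(\Lambda^q_i, B)\bigr). $$ Precisely, there is a unique bijection $\sigma \mapsto f_\sigma$ from the left side to the right side such that, for every map of simplicial sets $\sigma$, every $p \in \mathbb{N}$ and every $p$-simplex $x$ of $\Lambda^q_i$, viewed as a map $x : \Delta^p \to \Lambda^q_i$, the composition of $f_\sigma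 : A \to \mathrm{N}(\Lambda^q_i, B)$ with $\mathrm{N}(x, B) : \mathrm{N}(\Lambda^q_i, B) \to \mathrm{N}(\Delta^p, B) = \mathrm{Cyl}_p(B)$ equals $\sigma(x)$. -/

import Mathlib

open CategoryTheory Opposite Simplicial DirectSum TensorProduct
universe u

/-- A DG ring: a unital associative ring, graded by `ℤ` as the direct sum of the subgroups `gr i`
(this is `GradedAlgebra gr`), with an additive differential `d` of degree `1` satisfying `d ∘ d = 0`
and the graded Leibniz rule `d (a * b) = d a * b + (-1) ^ i * (a * d b)` for `a` of degree `i`.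
The zero ring is allowed. -/
structure DGRng : Type (u + 1) where
  carrier : Type u
  [ring : Ring carrier]
  gr : ℤ → Submodule ℤ carrier
  [graded : GradedAlgebra gr]
  d : carrier →ₗ[ℤ] carrier
  d_mem : ∀ (i : ℤ) (a : carrier), a ∈ gr i → d a ∈ gr (i + 1)
  d_d : ∀ a : carrier, d (d a) = 0
  leibniz : ∀ (i j : ℤ) (a b : carrier), a ∈ gr i → b ∈ gr j →
    d (a * b) = d a * b + i.negOnePow • (a * d b)

namespace DGRng

attribute [instance] DGRng.ring DGRng.graded

instance : CoeSort DGRng.{u} (Type u) := ⟨DGRng.carrier⟩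

/-- A DG ring homomorphism: a unital ring homomorphism of degree `0` commuting with the
differentials. -/
@[ext]
structure Hom (A B : DGRng.{u}) where
  toRingHom : A →+* B
  map_gr : ∀ (i : ℤ) (a : A), a ∈ A.gr i → toRingHom a ∈ B.gr i
  map_d : ∀ a : A, toRingHom (A.d a) = B.d (toRingHom a)

/-- The category of DG rings. -/
instance : Category DGRng.{u} where
  Hom A B := Hom A B
  id A := { toRingHom := RingHom.id A
            map_gr := fun _ _ h => h
            map_d := fun _ => rfl }
  comp f g := { toRingHom := g.toRingHom.comp f.toRingHom
                map_gr := fun i a h => g.map_gr i _ (f.map_gr i a h)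
                map_d := fun a => by simp [f.map_d, g.map_d] }

@[ext]
theorem hom_ext {A B : DGRng.{u}} {f g : A ⟶ B} (h : ∀ a, f.toRingHom a = g.toRingHom a) : f = g :=
  Hom.ext (RingHom.ext h)

@[simp] theorem id_apply {A : DGRng.{u}} (a : A) : Hom.toRingHom (𝟙 A) a = a := rfl
@[simp] theorem comp_apply {A B C : DGRng.{u}} (f : A ⟶ B) (g : B ⟶ C) (a : A) :
  Hom.toRingHom (f ≫ g) a = g.toRingHom (f.toRingHom a) := rfl

end DGRng

/-! ### The normalization of a cosimplicial ring

A cosimplicial ring is a functor `C : SimplexCategory ⥤ RingCat`. -/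

namespace CosimplicialRing

/-- The morphism `[q] ⟶ [n]` of the simplex category given by the sequence `(a, …, a + q)`.
To avoid side conditions it is defined for all values, by truncating at `n`; it is used only for
`a + q ≤ n`, see `win_eq_subinterval`. For `p + q = n`, the morphism `win 0 p n` is the front
inclusion `(0, …, p)`, and `win p q n` is the back inclusion `(p, …, p + q)`. -/
def win (a q n : ℕ) : ⦋q⦌ ⟶ ⦋n⦌ :=
  SimplexCategory.mkHom
    { toFun := fun k => ⟨min (a + k) n, by omega⟩
      monotone' := fun k l h => by
        have : (k : ℕ) ≤ l := h
        simp only [Fin.mk_le_mk]; omega }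

theorem win_apply (a q n : ℕ) (k : Fin (q + 1)) : ((win a q n).toOrderHom k : ℕ) = min (a + k) n := rfl

theorem hom_eq {p q : ℕ} {f g : ⦋p⦌ ⟶ ⦋q⦌} (h : ∀ k : Fin (p + 1), (f.toOrderHom k : ℕ) = g.toOrderHom k) :
   f = g := by
  ext k : 3; exact Fin.ext (h k)

theorem win_comp (a b q m n : ℕ) (h : b + q ≤ m) (h' : a + m ≤ n) : win b q m ≫ win a m n = win (a + b) q n := by
  apply hom_eq; intro k
  have := k.2
  simp only [SimplexCategory.comp_toOrderHom, OrderHom.comp_coe, Function.comp, win_apply]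
  omega

theorem win_self (n : ℕ) : win 0 n n = 𝟙 _ := by
  apply hom_eq; intro k
  have := k.2
  simp only [SimplexCategory.id_toOrderHom, OrderHom.id_coe, id, win_apply]
  omega

theorem win_eq_subinterval (a q n : ℕ) (h : a + q ≤ n) : win a q n = SimplexCategory.subinterval a q h := by
  apply hom_eq; intro k
  have := k.2
  rw [win_apply]
  change _ = (k : ℕ) + a
  omega

variable (C : SimplexCategory ⥤ RingCat.{u})

/-- All sequences `(c_p)` with `c_p ∈ C^p`, the product of the rings `C^p` as an abelian group. The
normalization of `C` is cut out of it below. -/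
def Cochain : Type u := ∀ p : ℕ, C.obj ⦋p⦌

instance : AddCommGroup (Cochain C) := inferInstanceAs (AddCommGroup (∀ p : ℕ, C.obj ⦋p⦌))

/-- The action of a morphism of the simplex category on a cosimplicial ring. -/
abbrev act {p q : ℕ} (f : ⦋p⦌ ⟶ ⦋q⦌) : C.obj ⦋p⦌ →+* C.obj ⦋q⦌ := (C.map f).hom

theorem act_act {p q r : ℕ} (f : ⦋p⦌ ⟶ ⦋q⦌) (g : ⦋q⦌ ⟶ ⦋r⦌) (x : C.obj ⦋p⦌) : act C g (act C f x) = act C (f ≫ g) x := by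
  unfold act
  rw [C.map_comp]; rfl

variable {C}
@[simp] theorem add_apply (b c : Cochain C) (n : ℕ) : (b + c) n = b n + c n := rfl
@[simp] theorem zero_apply (n : ℕ) : (0 : Cochain C) n = 0 := rfl
@[simp] theorem neg_apply (b : Cochain C) (n : ℕ) : (-b) n = - b n := rfl

/-- The Alexander-Whitney multiplication, extended biadditively: the component of `b * c` in
dimension `n` is the sum over `p + q = n` of the products in the ring `C^n` of the front image of
`b_p` and the back image of `c_q`. -/
instance : Mul (Cochain C) where
  mul b c := fun n => ∑ pq ∈ Finset.HasAntidiagonal.antidiagonal n,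
    act C (win 0 pq.1 n) (b pq.1) * act C (win pq.1 pq.2 n) (c pq.2)

theorem mul_apply (b c : Cochain C) (n : ℕ) : (b * c) n = ∑ pq ∈ Finset.HasAntidiagonal.antidiagonal n,
    act C (win 0 pq.1 n) (b pq.1) * act C (win pq.1 pq.2 n) (c pq.2) := rfl

/-- The unit is the unit of `C^0`, placed in dimension `0`. -/
instance : One (Cochain C) where
  one := fun n => match n with
    | 0 => 1
    | _ + 1 => 0

theorem one_zero : (1 : Cochain C) 0 = 1 := rfl
theorem one_succ (n : ℕ) : (1 : Cochain C) (n + 1) = 0 := rfl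
theorem one_ne (n : ℕ) (h : n ≠ 0) : (1 : Cochain C) n = 0 := by
  cases n with
  | zero => exact absurd rfl h
  | succ n => rfl

theorem act_win_self (n : ℕ) (x : C.obj ⦋n⦌) : act C (win 0 n n) x = x := by
  rw [win_self]; unfold act; rw [C.map_id]; rfl

protected theorem mul_assoc (a b c : Cochain C) : a * b * c = a * (b * c) := by
  funext n
  simp only [mul_apply, map_sum, map_mul, act_act, Finset.sum_mul, Finset.mul_sum]
  rw [Finset.sum_sigma', Finset.sum_sigma']
  refine Finset.sum_nbij' (fun x => ⟨(x.2.1, x.2.2 + x.1.2), (x.2.2, x.1.2)⟩)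
    (fun x => ⟨(x.1.1 + x.2.1, x.2.2), (x.1.1, x.2.1)⟩) ?_ ?_ ?_ ?_ ?_
  · rintro ⟨⟨m, r⟩, ⟨p, q⟩⟩; simp; omega
  · rintro ⟨⟨p, s⟩, ⟨q, r⟩⟩; simp; omega
  · rintro ⟨⟨m, r⟩, ⟨p, q⟩⟩; simp
  · rintro ⟨⟨p, s⟩, ⟨q, r⟩⟩; simp
  · rintro ⟨⟨m, r⟩, ⟨p, q⟩⟩ h
    simp only [Finset.mem_sigma, Finset.HasAntidiagonal.mem_antidiagonal] at h
    obtain ⟨h1, h2⟩ := h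
    dsimp only
    rw [win_comp _ _ _ _ _ (by omega) (by omega), win_comp _ _ _ _ _ (by omega) (by omega),
      win_comp _ _ _ _ _ (by omega) (by omega), win_comp _ _ _ _ _ (by omega) (by omega), mul_assoc]
    subst h2
    simp

/-- The ring structure given by the Alexander-Whitney multiplication. -/
instance : Ring (Cochain C) :=
  { (inferInstance : AddCommGroup (Cochain C)), (inferInstance : Mul (Cochain C)),
    (inferInstance : One (Cochain C)) with
    left_distrib := fun a b c => by
      funext n; simp [mul_apply, mul_add, Finset.sum_add_distrib]
    right_distrib := fun a b c => by
      funext n; simp [mul_apply, add_mul, Finset.sum_add_distrib]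
    zero_mul := fun a => by funext n; simp [mul_apply]
    mul_zero := fun a => by funext n; simp [mul_apply]
    mul_assoc := CosimplicialRing.mul_assoc
    one_mul := fun a => by
      funext n
      rw [mul_apply, Finset.sum_eq_single (0, n)]
      · rw [one_zero, map_one, one_mul, act_win_self]
      · rintro ⟨p, q⟩ h h'
        have : p ≠ 0 := by
          rintro rfl
          simp at h
          simp [h] at h'
        simp [one_ne _ this]
      · simp
    mul_one := fun a => by
      funext n
      rw [mul_apply, Finset.sum_eq_single (n, 0)]
      · rw [one_zero, map_one, mul_one, act_win_self]
      · rintro ⟨p, q⟩ h h'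
        have : q ≠ 0 := by
          rintro rfl
          simp at h
          simp [h] at h'
        simp [one_ne _ this]
      · simp }

/-- A total version (for proofs) of the coface `[n] ⟶ [n + 1]` missing `i`, see `delta_eq`. -/
def dlt (n i : ℕ) : ⦋n⦌ ⟶ ⦋n + 1⦌ :=
  SimplexCategory.mkHom
    { toFun := fun k => ⟨k + min 1 (k + 1 - i), by omega⟩
      monotone' := fun k l h => by
        have : (k : ℕ) ≤ l := h
        simp only [Fin.mk_le_mk]; omega }

/-- A total version (for proofs) of the codegeneracy `[n + 1] ⟶ [n]` at `i`, see `sigma_eq`. -/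
def sg (n i : ℕ) : ⦋n + 1⦌ ⟶ ⦋n⦌ :=
  SimplexCategory.mkHom
    { toFun := fun k => ⟨min n (k - min 1 (k - i)), by omega⟩
      monotone' := fun k l h => by
        have : (k : ℕ) ≤ l := h
        simp only [Fin.mk_le_mk]; omega }

theorem dlt_apply (n i : ℕ) (k : Fin (n + 1)) :
    ((dlt n i).toOrderHom k : ℕ) = k + min 1 (k + 1 - i) := rfl

theorem sg_apply (n i : ℕ) (k : Fin (n + 2)) :
    ((sg n i).toOrderHom k : ℕ) = min n (k - min 1 (k - i)) := rfl

theorem delta_eq (n : ℕ) (i : Fin (n + 2)) : SimplexCategory.δ i = dlt n i := by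
  apply hom_eq; intro k
  rw [dlt_apply]
  change ((Fin.succAbove i k : Fin (n + 2)) : ℕ) = _
  unfold Fin.succAbove
  simp only [Fin.lt_def, Fin.val_castSucc]
  split <;> simp <;> omega

theorem sigma_eq (n : ℕ) (i : Fin (n + 1)) : SimplexCategory.σ i = sg n i := by
  apply hom_eq; intro k
  rw [sg_apply]
  have := k.2
  have := i.2
  change ((Fin.predAbove i k : Fin (n + 1)) : ℕ) = _
  unfold Fin.predAbove
  simp only [Fin.lt_def, Fin.val_castSucc]
  split <;> simp <;> omega

theorem delta_hom (n : ℕ) (i : Fin (n + 2)) : (C.map (SimplexCategory.δ i)).hom = act C (dlt n i) := by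
  rw [← delta_eq]

theorem sigma_hom (n : ℕ) (i : Fin (n + 1)) : (C.map (SimplexCategory.σ i)).hom = act C (sg n i) := by
  rw [← sigma_eq]

/-- The differential, the alternating sum `∑ i, (-1) ^ i • δ^i` of the coface maps `C^n ⟶ C^(n+1)`. -/
def d : Cochain C →+ Cochain C where
  toFun c := fun n => match n with
    | 0 => 0
    | n + 1 => ∑ i : Fin (n + 2), (-1 : ℤ) ^ (i : ℕ) • (C.map (SimplexCategory.δ i)).hom (c n)
  map_zero' := by
    funext n
    cases n <;> simp
  map_add' b c := by
    funext n
    cases n with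
    | zero => exact (add_zero 0).symm
    | succ n =>
      refine Eq.trans ?_ Finset.sum_add_distrib
      simp only [add_apply, map_add, smul_add]

theorem d_zero (c : Cochain C) : d c 0 = 0 := rfl
theorem d_succ (c : Cochain C) (n : ℕ) : d c (n + 1) =
    ∑ i : Fin (n + 2), (-1 : ℤ) ^ (i : ℕ) • (C.map (SimplexCategory.δ i)).hom (c n) := rfl

theorem d_succ' (c : Cochain C) (n : ℕ) : d c (n + 1) =
    ∑ i ∈ Finset.range (n + 2), (-1 : ℤ) ^ i • act C (dlt n i) (c n) := by
  rw [d_succ, Finset.sum_range]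
  simp only [delta_hom]

theorem d_d (c : Cochain C) : d (d c) = 0 := by
  funext n
  match n with
  | 0 => rfl
  | 1 => rw [d_succ', d_zero]; simp
  | n + 2 =>
    rw [d_succ', zero_apply]
    simp only [d_succ', map_sum, map_zsmul, act_act, Finset.smul_sum, smul_smul]
    rw [← Finset.sum_product']
    refine Finset.sum_involution
      (fun x _ => if x.1 ≤ x.2 then (x.2 + 1, x.1) else (x.2, x.1 - 1)) ?_ ?_ ?_ ?_
    · rintro ⟨i, j⟩ h
      simp only [Finset.mem_product, Finset.mem_range] at h
      split
      · have : dlt n i ≫ dlt (n + 1) (j + 1) = dlt n j ≫ dlt (n + 1) i := by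
          apply hom_eq; intro k
          simp only [SimplexCategory.comp_toOrderHom, OrderHom.comp_coe, Function.comp, dlt_apply]
          omega
        rw [this]
        rw [← add_smul]
        have : (-1 : ℤ) ^ i * (-1) ^ j + (-1) ^ (j + 1) * (-1) ^ i = 0 := by ring
        rw [this, zero_smul]
      · have : dlt n j ≫ dlt (n + 1) i = dlt n (i - 1) ≫ dlt (n + 1) j := by
          apply hom_eq; intro k
          simp only [SimplexCategory.comp_toOrderHom, OrderHom.comp_coe, Function.comp, dlt_apply]
          omega
        rw [this]
        rw [← add_smul]
        obtain ⟨i, rfl⟩ : ∃ i', i = i' + 1 := ⟨i - 1, by omega⟩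
        have : (-1 : ℤ) ^ (i + 1) * (-1) ^ j + (-1) ^ j * (-1) ^ (i + 1 - 1) = 0 := by
          rw [Nat.add_sub_cancel]; ring
        rw [this, zero_smul]
    · rintro ⟨i, j⟩ h _
      dsimp only
      split <;> simp <;> omega
    · rintro ⟨i, j⟩ h
      simp only [Finset.mem_product, Finset.mem_range] at h ⊢
      split <;> simp <;> omega
    · rintro ⟨i, j⟩ h
      dsimp only
      split_ifs <;> simp at * <;> omega

/-- The sign `(-1) ^ n` in dimension `n`. -/
def sgn (b : Cochain C) : Cochain C := fun n => (-1 : ℤ) ^ n • b n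

theorem leibniz (b c : Cochain C) : d (b * c) = d b * c + sgn b * d c := by
  funext n
  match n with
  | 0 => simp [d_zero, mul_apply]
  | n + 1 =>
    rw [add_apply, mul_apply, mul_apply, Finset.Nat.sum_antidiagonal_succ,
      Finset.Nat.sum_antidiagonal_succ' (f := fun pq : ℕ × ℕ =>
        act C (win 0 pq.1 (n + 1)) (sgn b pq.1) * act C (win pq.1 pq.2 (n + 1)) (d c pq.2))]
    simp only [d_zero, map_zero, mul_zero, zero_mul, zero_add]
    rw [d_succ']
    simp only [mul_apply, map_sum, Finset.smul_sum]
    rw [Finset.sum_comm, ← Finset.sum_add_distrib]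
    refine Finset.sum_congr rfl ?_
    rintro ⟨p, q⟩ h
    simp only [Finset.HasAntidiagonal.mem_antidiagonal] at h
    subst h
    simp only [d_succ', sgn, map_sum, map_zsmul, act_act, map_mul, Finset.mul_sum, Finset.sum_mul]
    rw [show p + q + 2 = (p + 1) + (q + 1) by omega, Finset.sum_range_add,
      Finset.sum_range_succ _ (p + 1), Finset.sum_range_succ' _ (q + 1)]
    have e1 : ∀ i < p + 1, win 0 p (p + q) ≫ dlt (p + q) i = dlt p i ≫ win 0 (p + 1) (p + q + 1) := by
      intro i hi
      apply hom_eq; intro k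
      have := k.2
      simp only [SimplexCategory.comp_toOrderHom, OrderHom.comp_coe, Function.comp, dlt_apply, win_apply]
      omega
    have e2 : ∀ i < p + 1, win p q (p + q) ≫ dlt (p + q) i = win (p + 1) q (p + q + 1) := by
      intro i hi
      apply hom_eq; intro k
      have := k.2
      simp only [SimplexCategory.comp_toOrderHom, OrderHom.comp_coe, Function.comp, dlt_apply, win_apply]
      omega
    have e3 : ∀ j, win 0 p (p + q) ≫ dlt (p + q) (p + 1 + j) = win 0 p (p + q + 1) := by
      intro i
      apply hom_eq; intro k
      have := k.2
      simp only [SimplexCategory.comp_toOrderHom, OrderHom.comp_coe, Function.comp, dlt_apply, win_apply]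
      omega
    have e4 : ∀ j, win p q (p + q) ≫ dlt (p + q) (p + 1 + j) =
        dlt q (j + 1) ≫ win p (q + 1) (p + q + 1) := by
      intro i
      apply hom_eq; intro k
      have := k.2
      simp only [SimplexCategory.comp_toOrderHom, OrderHom.comp_coe, Function.comp, dlt_apply, win_apply]
      omega
    have e5 : dlt p (p + 1) ≫ win 0 (p + 1) (p + q + 1) = win 0 p (p + q + 1) := by
      apply hom_eq; intro k
      have := k.2
      simp only [SimplexCategory.comp_toOrderHom, OrderHom.comp_coe, Function.comp, dlt_apply, win_apply]
      omega
    have e6 : dlt q 0 ≫ win p (q + 1) (p + q + 1) = win (p + 1) q (p + q + 1) := by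
      apply hom_eq; intro k
      have := k.2
      simp only [SimplexCategory.comp_toOrderHom, OrderHom.comp_coe, Function.comp, dlt_apply, win_apply]
      omega
    rw [e5, e6]
    have f1 : ∑ x ∈ Finset.range (p + 1), (-1 : ℤ) ^ x •
        (act C (win 0 p (p + q) ≫ dlt (p + q) x) (b p) * act C (win p q (p + q) ≫ dlt (p + q) x) (c q)) =
        ∑ x ∈ Finset.range (p + 1), (-1 : ℤ) ^ x •
        act C (dlt p x ≫ win 0 (p + 1) (p + q + 1)) (b p) * act C (win (p + 1) q (p + q + 1)) (c q) := by
      refine Finset.sum_congr rfl fun x hx => ?_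
      rw [Finset.mem_range] at hx
      rw [e1 x hx, e2 x hx, smul_mul_assoc]
    have f2 : ∑ x ∈ Finset.range (q + 1), (-1 : ℤ) ^ (p + 1 + x) •
        (act C (win 0 p (p + q) ≫ dlt (p + q) (p + 1 + x)) (b p) *
          act C (win p q (p + q) ≫ dlt (p + q) (p + 1 + x)) (c q)) =
        ∑ x ∈ Finset.range (q + 1), (-1 : ℤ) ^ p • act C (win 0 p (p + q + 1)) (b p) *
         (-1 : ℤ) ^ (x + 1) • act C (dlt q (x + 1) ≫ win p (q + 1) (p + q + 1)) (c q) := by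
      refine Finset.sum_congr rfl fun x hx => ?_
      rw [e3, e4, smul_mul_smul_comm]
      congr 1
      ring
    rw [f1, f2, pow_zero, one_smul, smul_mul_assoc, smul_mul_assoc, pow_succ]
    simp only [mul_neg, mul_one, neg_smul]
    abel

/-- All codegeneracy maps `C^(p+1) ⟶ C^p` vanish on `c`. -/
def IsNormalized (c : Cochain C) : Prop :=
  ∀ (p : ℕ) (i : Fin (p + 1)), (C.map (SimplexCategory.σ i)).hom (c (p + 1)) = 0

theorem isNormalized_iff (c : Cochain C) : IsNormalized c ↔
    ∀ p i : ℕ, i ≤ p → act C (sg p i) (c (p + 1)) = 0 := by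
  constructor
  · intro h p i hi
    have := h p ⟨i, by omega⟩
    rwa [sigma_hom] at this
  · intro h p i
    rw [sigma_hom]
    exact h p i (by omega)

theorem IsNormalized.mul {b c : Cochain C} (hb : IsNormalized b) (hc : IsNormalized c) :
    IsNormalized (b * c) := by
  rw [isNormalized_iff] at *
  intro n i hi
  rw [mul_apply, map_sum]
  refine Finset.sum_eq_zero ?_
  rintro ⟨p, q⟩ h
  simp only [Finset.HasAntidiagonal.mem_antidiagonal] at h
  simp only [map_mul, act_act]
  by_cases hp : i < p
  · obtain ⟨p, rfl⟩ : ∃ p', p = p' + 1 := ⟨p - 1, by omega⟩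
    have : win 0 (p + 1) (n + 1) ≫ sg n i = sg p i ≫ win 0 p n := by
      apply hom_eq; intro k
      have := k.2
      simp only [SimplexCategory.comp_toOrderHom, OrderHom.comp_coe, Function.comp, sg_apply, win_apply]
      omega
    rw [this, ← act_act, hb p i (by omega), map_zero, zero_mul]
  · obtain ⟨q, rfl⟩ : ∃ q', q = q' + 1 := ⟨q - 1, by omega⟩
    have : win p (q + 1) (n + 1) ≫ sg n i = sg q (i - p) ≫ win p q n := by
      apply hom_eq; intro k
      have := k.2
      simp only [SimplexCategory.comp_toOrderHom, OrderHom.comp_coe, Function.comp, sg_apply, win_apply]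
      omega
    have z : act C (win p (q + 1) (n + 1) ≫ sg n i) (c (q + 1)) = 0 := by
      rw [this, ← act_act, hc q (i - p) (by omega), map_zero]
    rw [z, mul_zero]

theorem IsNormalized.d {c : Cochain C} (hc : IsNormalized c) : IsNormalized (d c) := by
  rw [isNormalized_iff] at *
  intro n j hj
  rw [d_succ', map_sum]
  simp only [map_zsmul, act_act]
  rw [Finset.sum_eq_add j (j + 1) (by omega)]
  · have e1 : dlt n j ≫ sg n j = 𝟙 _ := by
      apply hom_eq; intro k
      have := k.2
      simp only [SimplexCategory.comp_toOrderHom, OrderHom.comp_coe, Function.comp, sg_apply,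
        dlt_apply, SimplexCategory.id_toOrderHom, OrderHom.id_coe, id]
      omega
    have e2 : dlt n (j + 1) ≫ sg n j = 𝟙 _ := by
      apply hom_eq; intro k
      have := k.2
      simp only [SimplexCategory.comp_toOrderHom, OrderHom.comp_coe, Function.comp, sg_apply,
        dlt_apply, SimplexCategory.id_toOrderHom, OrderHom.id_coe, id]
      omega
    rw [e1, e2, ← add_smul]
    have : (-1 : ℤ) ^ j + (-1) ^ (j + 1) = 0 := by ring
    rw [this, zero_smul]
  · intro i hi hij
    rw [Finset.mem_range] at hi
    obtain ⟨n, rfl⟩ : ∃ n', n = n' + 1 := ⟨n - 1, by omega⟩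
    by_cases h : i < j
    · have : dlt (n + 1) i ≫ sg (n + 1) j = sg n (j - 1) ≫ dlt n i := by
        apply hom_eq; intro k
        have := k.2
        simp only [SimplexCategory.comp_toOrderHom, OrderHom.comp_coe, Function.comp, sg_apply,
          dlt_apply]
        omega
      rw [this, ← act_act, hc _ _ (by omega), map_zero, smul_zero]
    · have : dlt (n + 1) i ≫ sg (n + 1) j = sg n j ≫ dlt n (i - 1) := by
        apply hom_eq; intro k
        have := k.2
        simp only [SimplexCategory.comp_toOrderHom, OrderHom.comp_coe, Function.comp, sg_apply,
          dlt_apply]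
        omega
      rw [this, ← act_act, hc _ _ (by omega), map_zero, smul_zero]
  · intro h; exact absurd (Finset.mem_range.2 (by omega)) h
  · intro h; exact absurd (Finset.mem_range.2 (by omega)) h

end CosimplicialRing

namespace CosimplicialRing
variable (C : SimplexCategory ⥤ RingCat.{u})

/-- The underlying ring of the normalization `N(C) = ⨁ p, N^p(C)`, where `N^p(C) ⊆ C^p` is the
intersection of the kernels of all codegeneracies: the sequences with all components normalized and
with only finitely many nonzero components. -/
def normalized : Subring (Cochain C) where
  carrier := {c | IsNormalized c ∧ ∃ N : ℕ, ∀ p ≥ N, c p = 0}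
  zero_mem' := ⟨fun p i => map_zero _, 0, fun _ _ => rfl⟩
  one_mem' := ⟨fun p i => by rw [one_succ, map_zero], 1, fun p hp => one_ne p (by omega)⟩
  add_mem' := by
    rintro b c ⟨hb, M, hM⟩ ⟨hc, N, hN⟩
    refine ⟨fun p i => ?_, M + N, fun p hp => ?_⟩
    · rw [add_apply, map_add, hb, hc, add_zero]
    · rw [add_apply, hM p (by omega), hN p (by omega), add_zero]
  neg_mem' := by
    rintro b ⟨hb, M, hM⟩
    refine ⟨fun p i => ?_, M, fun p hp => ?_⟩
    · rw [neg_apply, map_neg, hb, neg_zero]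
    · rw [neg_apply, hM p hp, neg_zero]
  mul_mem' := by
    rintro b c ⟨hb, M, hM⟩ ⟨hc, N, hN⟩
    refine ⟨hb.mul hc, M + N, fun n hn => ?_⟩
    rw [mul_apply]
    refine Finset.sum_eq_zero ?_
    rintro ⟨p, q⟩ h
    simp only [Finset.HasAntidiagonal.mem_antidiagonal] at h
    by_cases hp : M ≤ p
    · simp only [hM p hp, map_zero, zero_mul]
    · simp only [hN q (by omega), map_zero, mul_zero]

variable {C}

theorem zsmul_apply (z : ℤ) (b : Cochain C) (n : ℕ) : (z • b) n = z • b n :=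
  map_zsmul (Pi.evalAddMonoidHom (fun p : ℕ => C.obj ⦋p⦌) n) z b

theorem d_mem_normalized {c : Cochain C} (h : c ∈ normalized C) : d c ∈ normalized C := by
  obtain ⟨h, N, hN⟩ := h
  refine ⟨h.d, N + 1, fun p hp => ?_⟩
  obtain ⟨p, rfl⟩ : ∃ p', p = p' + 1 := ⟨p - 1, by omega⟩
  rw [d_succ]
  refine Finset.sum_eq_zero fun i _ => ?_
  rw [hN p (by omega), map_zero, smul_zero]

variable (C) in
/-- The degree `i` part of `N(C)`: the sequences concentrated in dimension `i`. It is `0` for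
negative `i`. -/
def grading (i : ℤ) : Submodule ℤ (normalized C) where
  carrier := {c | ∀ p : ℕ, (p : ℤ) ≠ i → c.1 p = 0}
  zero_mem' := fun _ _ => rfl
  add_mem' := by
    intro b c hb hc p hp
    change b.1 p + c.1 p = 0
    rw [hb p hp, hc p hp, add_zero]
  smul_mem' := by
    intro z b hb p hp
    change (z • b.1) p = 0
    rw [zsmul_apply, hb p hp, smul_zero]

/-- The projection to the degree `i` part. -/
def proj (i : ℤ) : normalized C →+ normalized C where
  toFun c := ⟨fun p => if (p : ℤ) = i then c.1 p else 0, by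
    obtain ⟨h, N, hN⟩ := c.2
    refine ⟨fun p j => ?_, N, fun p hp => ?_⟩
    · change (C.map (SimplexCategory.σ j)).hom (if ((p + 1 : ℕ) : ℤ) = i then c.1 (p + 1) else 0) = 0
      split
      · exact h p j
      · exact map_zero _
    · simp only [hN p hp, ite_self]⟩
  map_zero' := by
    apply Subtype.ext; funext p
    exact ite_self _
  map_add' b c := by
    apply Subtype.ext; funext p
    change (if (p : ℤ) = i then b.1 p + c.1 p else 0) =
      (if (p : ℤ) = i then b.1 p else 0) + (if (p : ℤ) = i then c.1 p else 0)
    split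
    · rfl
    · exact (add_zero _).symm

theorem proj_apply (i : ℤ) (c : normalized C) (p : ℕ) :
    (proj i c).1 p = if (p : ℤ) = i then c.1 p else 0 := rfl

theorem proj_mem (i : ℤ) (c : normalized C) : proj i c ∈ grading C i := by
  intro p hp
  rw [proj_apply, if_neg hp]

theorem proj_of_mem {i j : ℤ} {c : normalized C} (hc : c ∈ grading C j) :
    proj i c = if j = i then c else 0 := by
  apply Subtype.ext; funext p
  rw [proj_apply]
  by_cases hp : (p : ℤ) = j
  · subst hp
    split <;> rfl
  · rw [hc p hp, ite_self]
    split
    · exact (hc p hp).symm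
    · rfl

theorem sum_apply {ι : Type*} (s : Finset ι) (f : ι → normalized C) (n : ℕ) :
    (∑ i ∈ s, f i).1 n = ∑ i ∈ s, (f i).1 n :=
  map_sum ((Pi.evalAddMonoidHom (fun p : ℕ => C.obj ⦋p⦌) n).comp
    (normalized C).subtype.toAddMonoidHom) f s

theorem isInternal : DirectSum.IsInternal (grading C) := by
  constructor
  · have key : ∀ (x : ⨁ i, grading C i) (i : ℤ),
        proj i (DirectSum.coeAddMonoidHom (grading C) x) = x i := by
      intro x i
      induction x using DirectSum.induction_on with
      | zero => simp
      | of j y =>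
        rw [DirectSum.coeAddMonoidHom_of, proj_of_mem y.2]
        split
        · next h => subst h; rw [DirectSum.of_eq_same]
        · next h => rw [DirectSum.of_eq_of_ne _ _ _ (Ne.symm h)]; rfl
      | add x y hx hy => rw [map_add, map_add, hx, hy]; rfl
    rw [injective_iff_map_eq_zero]
    intro x hx
    ext i : 2
    rw [← key x i, hx, map_zero]; rfl
  · intro c
    obtain ⟨h, N, hN⟩ := c.2
    refine ⟨∑ p ∈ Finset.range N, DirectSum.of (fun i => grading C i) (p : ℤ)
      ⟨proj p c, proj_mem _ _⟩, ?_⟩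
    rw [map_sum]
    simp only [DirectSum.coeAddMonoidHom_of]
    apply Subtype.ext; funext n
    rw [sum_apply]
    simp only [proj_apply, Nat.cast_inj]
    rw [Finset.sum_ite_eq]
    split
    · rfl
    · next h => 
      rw [Finset.mem_range] at h
      exact (hN n (by omega)).symm

instance : SetLike.GradedMonoid (grading C) where
  one_mem := fun p hp => one_ne p (by simpa using hp)
  mul_mem := by
    intro i j b c hb hc n hn
    change (b.1 * c.1) n = 0
    rw [mul_apply]
    refine Finset.sum_eq_zero ?_
    rintro ⟨p, q⟩ h
    simp only [Finset.HasAntidiagonal.mem_antidiagonal] at h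
    by_cases hp : (p : ℤ) = i
    · simp only [hc q (by omega), map_zero, mul_zero]
    · simp only [hb p hp, map_zero, zero_mul]

noncomputable instance : GradedAlgebra (grading C) :=
  { (inferInstance : SetLike.GradedMonoid (grading C)), isInternal.chooseDecomposition with }

theorem sgn_of_mem {i : ℤ} {b : normalized C} (hb : b ∈ grading C i) :
    sgn b.1 = (i.negOnePow • b : normalized C).1 := by
  funext n
  by_cases hn : (n : ℤ) = i
  · subst hn
    change _ = ((((n : ℤ).negOnePow : ℤˣ) : ℤ) • b.1) n
    rw [zsmul_apply]
    simp [sgn, Int.negOnePow_def]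
  · change _ = (((i.negOnePow : ℤˣ) : ℤ) • b.1) n
    rw [zsmul_apply, hb n hn, smul_zero]
    change _ • b.1 n = _
    rw [hb n hn, smul_zero]

theorem act_naturality {C D : SimplexCategory ⥤ RingCat.{u}} (f : C ⟶ D) {p q : ℕ}
    (s : ⦋p⦌ ⟶ ⦋q⦌) (x : C.obj ⦋p⦌) :
    (f.app ⦋q⦌).hom (act C s x) = act D s ((f.app ⦋p⦌).hom x) := by
  have := f.naturality s
  exact congrArg (fun g : C.obj ⦋p⦌ ⟶ D.obj ⦋q⦌ => g.hom x) this

/-- The ring homomorphism induced by a morphism of cosimplicial rings. -/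
def cochainMap {C D : SimplexCategory ⥤ RingCat.{u}} (f : C ⟶ D) : Cochain C →+* Cochain D where
  toFun c := fun p => (f.app ⦋p⦌).hom (c p)
  map_zero' := by funext p; exact map_zero _
  map_one' := by
    funext p
    cases p with
    | zero => exact map_one (f.app ⦋0⦌).hom
    | succ p => exact map_zero (f.app ⦋p + 1⦌).hom
  map_add' b c := by funext p; exact map_add (f.app ⦋p⦌).hom (b p) (c p)
  map_mul' b c := by
    funext n
    rw [mul_apply]
    change (f.app ⦋n⦌).hom ((b * c) n) = _
    rw [mul_apply]
    simp only [map_sum, map_mul, act_naturality]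
    rfl

theorem cochainMap_apply {C D : SimplexCategory ⥤ RingCat.{u}} (f : C ⟶ D) (c : Cochain C) (p : ℕ) :
    cochainMap f c p = (f.app ⦋p⦌).hom (c p) := rfl

theorem cochainMap_mem {C D : SimplexCategory ⥤ RingCat.{u}} (f : C ⟶ D) {c : Cochain C}
    (hc : c ∈ normalized C) : cochainMap f c ∈ normalized D := by
  obtain ⟨h, N, hN⟩ := hc
  refine ⟨fun p i => ?_, N, fun p hp => ?_⟩
  · rw [cochainMap_apply]
    refine (act_naturality f (SimplexCategory.σ i) (c (p + 1))).symm.trans ?_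
    unfold act
    rw [h p i, map_zero]
  · rw [cochainMap_apply, hN p hp, map_zero]

theorem cochainMap_d {C D : SimplexCategory ⥤ RingCat.{u}} (f : C ⟶ D) (c : Cochain C) :
    cochainMap f (d c) = d (cochainMap f c) := by
  funext n
  cases n with
  | zero => exact map_zero (f.app ⦋0⦌).hom
  | succ n =>
    rw [cochainMap_apply, d_succ', d_succ']
    simp only [map_sum, map_zsmul, act_naturality, cochainMap_apply]

end CosimplicialRing

open CosimplicialRing in
/-- The normalization functor from cosimplicial rings to DG rings. -/
noncomputable def normalization : (SimplexCategory ⥤ RingCat.{u}) ⥤ DGRng.{u} where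
  obj C :=
    { carrier := normalized C
      gr := grading C
      d := (((d : Cochain C →+ Cochain C).comp (normalized C).subtype.toAddMonoidHom).codRestrict
        (normalized C).toAddSubgroup (fun c => d_mem_normalized c.2)).toIntLinearMap
      d_mem := by
        intro i c hc p hp
        change d c.1 p = 0
        match p with
        | 0 => rfl
        | p + 1 =>
          rw [d_succ]
          refine Finset.sum_eq_zero fun j _ => ?_
          rw [hc p (by push_cast at hp; omega), map_zero, smul_zero]
      d_d := fun c => Subtype.ext (d_d c.1)
      leibniz := by
        intro i j b c hb _
        apply Subtype.ext
        refine (CosimplicialRing.leibniz b.1 c.1).trans ?_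
        rw [sgn_of_mem hb, ← mul_smul_comm, mul_smul_comm, ← smul_mul_assoc]
        rfl }
  map {C D} f :=
    { toRingHom := ((cochainMap f).comp (normalized C).subtype).codRestrict (normalized D)
        (fun c => cochainMap_mem f c.2)
      map_gr := fun i c hc p hp => by
        change (f.app ⦋p⦌).hom (c.1 p) = 0
        rw [hc p hp, map_zero]
      map_d := fun c => Subtype.ext (cochainMap_d f c.1) }
  map_id C := rfl
  map_comp f g := rfl

/-! ### The tensor product of DG rings over `ℤ` -/

namespace DGRng

/-- The additive map which is multiplication by `(-1) ^ i` in degree `i`. -/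
noncomputable def sign (A : DGRng.{u}) : A →ₗ[ℤ] A :=
  (DirectSum.toModule ℤ ℤ A fun i => ((i.negOnePow : ℤˣ) : ℤ) • (A.gr i).subtype) ∘ₗ
    (DirectSum.decomposeLinearEquiv A.gr).toLinearMap

theorem sign_of_mem (A : DGRng.{u}) {i : ℤ} {a : A} (ha : a ∈ A.gr i) :
    A.sign a = i.negOnePow • a := by
  have h : DirectSum.decomposeLinearEquiv A.gr a =
      DirectSum.lof ℤ ℤ (fun i => A.gr i) i ⟨a, ha⟩ :=
    DirectSum.decompose_of_mem _ ha
  rw [sign, LinearMap.comp_apply, LinearEquiv.coe_coe, h, DirectSum.toModule_lof]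
  rfl

/-- The homogeneous elements. -/
def homogeneous (A : DGRng.{u}) : Set A := Set.ofPred fun x => ∃ i, x ∈ A.gr i

theorem span_homogeneous (A : DGRng.{u}) :
    Submodule.span ℤ (homogeneous A) = ⊤ := by
  classical
  rw [eq_top_iff]
  rintro a -
  rw [← DirectSum.sum_support_decompose A.gr a]
  exact Submodule.sum_mem _ fun i _ => Submodule.subset_span ⟨i, SetLike.coe_mem _⟩

/-- The underlying ring of `A ⊗ B`: the abelian group `A ⊗[ℤ] B` with the multiplication
`(a ⊗ b) * (a' ⊗ b') = (-1) ^ (j * i) • (a * a') ⊗ (b * b')` for `b` of degree `j` and `a'` of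
degree `i`, see `tmul_mul_tmul`. -/
def TensorCarrier (A B : DGRng.{u}) : Type u := GradedTensorProduct ℤ A.gr B.gr

noncomputable instance (A B : DGRng.{u}) : Ring (TensorCarrier A B) :=
  inferInstanceAs (Ring (GradedTensorProduct ℤ A.gr B.gr))

variable (A B : DGRng.{u})

/-- The identity map from the tensor product of abelian groups to the underlying ring of `A ⊗ B`. -/
noncomputable def tensorOf : A ⊗[ℤ] B →ₗ[ℤ] TensorCarrier A B :=
  AddMonoidHom.toIntLinearMap
    ((GradedTensorProduct.of ℤ A.gr B.gr).toAddEquiv.toAddMonoidHom : A ⊗[ℤ] B →+ GradedTensorProduct ℤ A.gr B.gr)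

/-- The inverse of `tensorOf`. -/
noncomputable def tensorTo : TensorCarrier A B →ₗ[ℤ] A ⊗[ℤ] B :=
  AddMonoidHom.toIntLinearMap
    ((GradedTensorProduct.of ℤ A.gr B.gr).symm.toAddEquiv.toAddMonoidHom : GradedTensorProduct ℤ A.gr B.gr →+ A ⊗[ℤ] B)

@[simp] theorem tensorTo_of (x : A ⊗[ℤ] B) : tensorTo A B (tensorOf A B x) = x := rfl
@[simp] theorem tensorOf_to (x : TensorCarrier A B) : tensorOf A B (tensorTo A B x) = x := rfl

variable {A B} in
/-- The pure tensor `a ⊗ b`. -/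
noncomputable def tm (a : A) (b : B) : TensorCarrier A B := tensorOf A B (a ⊗ₜ[ℤ] b)

theorem one_def : (1 : TensorCarrier A B) = tm 1 1 := rfl

theorem tmul_mul_tmul {i j : ℤ} (a : A) {a' : A} {b : B} (b' : B)
    (hb : b ∈ B.gr j) (ha' : a' ∈ A.gr i) :
    (tm a b * tm a' b' : TensorCarrier A B) =
      (j * i).negOnePow • (tm (a * a') (b * b') : TensorCarrier A B) :=
  GradedTensorProduct.tmul_coe_mul_coe_tmul A.gr B.gr a ⟨b, hb⟩ ⟨a', ha'⟩ b'

theorem tm_add_left (a a' : A) (b : B) : tm (a + a') b = tm a b + tm a' b := by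
  unfold tm; rw [TensorProduct.add_tmul, map_add]
theorem tm_add_right (a : A) (b b' : B) : tm a (b + b') = tm a b + tm a b' := by
  unfold tm; rw [TensorProduct.tmul_add, map_add]
theorem tm_smul_left (z : ℤ) (a : A) (b : B) : tm (z • a) b = z • tm a b := by
  unfold tm; rw [← TensorProduct.smul_tmul', map_smul]
theorem tm_smul_right (z : ℤ) (a : A) (b : B) : tm a (z • b) = z • tm a b := by
  unfold tm; rw [TensorProduct.tmul_smul, map_smul]

theorem tm_zero_left (b : B) : (tm 0 b : TensorCarrier A B) = 0 := by
  unfold tm; rw [TensorProduct.zero_tmul, map_zero]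
theorem tm_zero_right (a : A) : (tm a 0 : TensorCarrier A B) = 0 := by
  unfold tm; rw [TensorProduct.tmul_zero, map_zero]

/-- The degree `n` part of `A ⊗ B`, generated by the `a ⊗ b` with `a` of degree `i`, `b` of degree `j`
and `i + j = n`. -/
noncomputable def tensorGr (n : ℤ) : Submodule ℤ (TensorCarrier A B) :=
  Submodule.span ℤ {x | ∃ i j : ℤ, i + j = n ∧ ∃ a ∈ A.gr i, ∃ b ∈ B.gr j, x = tm a b}

theorem tmul_mem_tensorGr {i j : ℤ} {a : A} {b : B} (ha : a ∈ A.gr i) (hb : b ∈ B.gr j) :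
    (tm a b : TensorCarrier A B) ∈ tensorGr A B (i + j) :=
  Submodule.subset_span ⟨i, j, rfl, a, ha, b, hb, rfl⟩

theorem span_tensor :
    Submodule.span ℤ {x | ∃ i j : ℤ, ∃ a ∈ A.gr i, ∃ b ∈ B.gr j, x = (tm a b : TensorCarrier A B)}
      = ⊤ := by
  set S := Submodule.span ℤ
    {x | ∃ i j : ℤ, ∃ a ∈ A.gr i, ∃ b ∈ B.gr j, x = (tm a b : TensorCarrier A B)} with hS
  rw [eq_top_iff]
  rintro x -
  rw [← tensorOf_to A B x]
  generalize tensorTo A B x = x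
  induction x using TensorProduct.induction_on with
  | zero => rw [map_zero]; exact zero_mem _
  | add x y hx hy => rw [map_add]; exact add_mem hx hy
  | tmul a b =>
    have ha : a ∈ Submodule.span ℤ (homogeneous A) := by
      rw [span_homogeneous]; trivial
    have hb : b ∈ Submodule.span ℤ (homogeneous B) := by
      rw [span_homogeneous]; trivial
    induction ha using Submodule.span_induction with
    | zero => rw [TensorProduct.zero_tmul, map_zero]; exact zero_mem _
    | add a a' _ _ h h' => rw [TensorProduct.add_tmul, map_add]; exact add_mem h h'
    | smul z a _ h =>
      rw [← TensorProduct.smul_tmul', map_smul]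
      exact S.smul_mem z h
    | mem a ha =>
      obtain ⟨i, ha⟩ := ha
      induction hb using Submodule.span_induction with
      | zero => rw [TensorProduct.tmul_zero, map_zero]; exact zero_mem _
      | add a a' _ _ h h' => rw [TensorProduct.tmul_add, map_add]; exact add_mem h h'
      | smul z b _ h =>
        rw [TensorProduct.tmul_smul, map_smul]
        exact S.smul_mem z h
      | mem b hb =>
        obtain ⟨j, hb⟩ := hb
        exact Submodule.subset_span ⟨i, j, a, ha, b, hb, rfl⟩

/-- The component in total degree `i + j` of the decomposition map. -/
noncomputable def decompAux (i j : ℤ) : A.gr i →ₗ[ℤ] B.gr j →ₗ[ℤ] ⨁ n, tensorGr A B n :=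
  LinearMap.mk₂ ℤ (fun a b => DirectSum.lof ℤ ℤ (fun n => tensorGr A B n) (i + j)
      ⟨tm (a : A) (b : B), tmul_mem_tensorGr A B a.2 b.2⟩)
    (fun a a' b => by
      rw [← map_add]; congr 1; apply Subtype.ext
      exact tm_add_left _ _ _ _ _)
    (fun z a b => by
      rw [← map_smul]; congr 1)
    (fun a b b' => by
      rw [← map_add]; congr 1; apply Subtype.ext
      exact tm_add_right _ _ _ _ _)
    (fun z a b => by
      rw [← map_smul]; congr 1; apply Subtype.ext
      exact tm_smul_right _ _ _ _ _)

/-- The decomposition of `A ⊗ B` into its homogeneous parts. -/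
noncomputable def decomp : TensorCarrier A B →ₗ[ℤ] ⨁ n, tensorGr A B n :=
  TensorProduct.lift
    ((DirectSum.toModule ℤ ℤ _ fun i => LinearMap.flip
      (DirectSum.toModule ℤ ℤ _ fun j => (decompAux A B i j).flip)).compl₁₂
      (DirectSum.decomposeLinearEquiv A.gr).toLinearMap
      (DirectSum.decomposeLinearEquiv B.gr).toLinearMap) ∘ₗ
  tensorTo A B

theorem decomp_tmul {i j : ℤ} {a : A} {b : B} (ha : a ∈ A.gr i) (hb : b ∈ B.gr j) :
    decomp A B (tm a b) = DirectSum.lof ℤ ℤ (fun n => tensorGr A B n) (i + j)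
      ⟨tm a b, tmul_mem_tensorGr A B ha hb⟩ := by
  have h : DirectSum.decomposeLinearEquiv A.gr a =
      DirectSum.lof ℤ ℤ (fun i => A.gr i) i ⟨a, ha⟩ := DirectSum.decompose_of_mem _ ha
  have h' : DirectSum.decomposeLinearEquiv B.gr b =
      DirectSum.lof ℤ ℤ (fun i => B.gr i) j ⟨b, hb⟩ := DirectSum.decompose_of_mem _ hb
  change TensorProduct.lift (LinearMap.compl₁₂ _ _ _) (a ⊗ₜ[ℤ] b) = _
  rw [TensorProduct.lift.tmul, LinearMap.compl₁₂_apply, LinearEquiv.coe_coe, LinearEquiv.coe_coe,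
    h, h', DirectSum.toModule_lof, LinearMap.flip_apply, DirectSum.toModule_lof]
  rfl

theorem decomp_mem {n : ℤ} {x : TensorCarrier A B} (hx : x ∈ tensorGr A B n) :
    decomp A B x = DirectSum.lof ℤ ℤ (fun n => tensorGr A B n) n ⟨x, hx⟩ := by
  induction hx using Submodule.span_induction with
  | zero => rw [map_zero]; exact (map_zero _).symm
  | add x y hx hy h h' => rw [map_add, h, h', ← map_add]; rfl
  | smul z x hx h => rw [map_smul, h, ← map_smul]; rfl
  | mem x hx =>
    obtain ⟨i, j, rfl, a, ha, b, hb, rfl⟩ := hx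
    exact decomp_tmul A B ha hb

instance : SetLike.GradedMonoid (tensorGr A B) where
  one_mem := by
    have := tmul_mem_tensorGr A B (SetLike.GradedOne.one_mem (A := A.gr))
      (SetLike.GradedOne.one_mem (A := B.gr))
    rwa [add_zero] at this
  mul_mem := by
    intro n m x y hx hy
    induction hx using Submodule.span_induction with
    | zero => rw [zero_mul]; exact zero_mem _
    | add x x' _ _ h h' => rw [add_mul]; exact add_mem h h'
    | smul z x _ h => rw [smul_mul_assoc]; exact Submodule.smul_mem _ _ h
    | mem x hx =>
      obtain ⟨i, j, rfl, a, ha, b, hb, rfl⟩ := hx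
      induction hy using Submodule.span_induction with
      | zero => rw [mul_zero]; exact zero_mem _
      | add x x' _ _ h h' => rw [mul_add]; exact add_mem h h'
      | smul z x _ h => rw [mul_smul_comm]; exact Submodule.smul_mem _ _ h
      | mem y hy =>
        obtain ⟨k, l, rfl, a', ha', b', hb', rfl⟩ := hy
        rw [tmul_mul_tmul A B a b' hb ha', Units.smul_def]
        refine Submodule.smul_mem _ _ ?_
        rw [add_add_add_comm]
        exact tmul_mem_tensorGr A B (SetLike.GradedMul.mul_mem ha ha')
          (SetLike.GradedMul.mul_mem hb hb')

noncomputable instance : GradedAlgebra (tensorGr A B) :=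
  { (inferInstance : SetLike.GradedMonoid (tensorGr A B)) with
    decompose' := decomp A B
    left_inv := by
      intro x
      have hx : x ∈ (⊤ : Submodule ℤ (TensorCarrier A B)) := trivial
      rw [← span_tensor] at hx
      induction hx using Submodule.span_induction with
      | zero => rw [map_zero, map_zero]
      | add x y _ _ h h' => rw [map_add, map_add, h, h']
      | smul z x _ h => rw [map_smul, map_zsmul, h]
      | mem x hx =>
        obtain ⟨i, j, a, ha, b, hb, rfl⟩ := hx
        rw [decomp_tmul A B ha hb]
        exact DirectSum.coeAddMonoidHom_of (tensorGr A B) _ _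
    right_inv := by
      intro x
      induction x using DirectSum.induction_on with
      | zero => rw [map_zero, map_zero]
      | add x y h h' => rw [map_add, map_add, h, h']
      | of n x =>
        rw [DirectSum.coeAddMonoidHom_of]
        exact decomp_mem A B x.2 }

/-- The differential of `A ⊗ B`, with `d (a ⊗ b) = d a ⊗ b + (-1) ^ i • a ⊗ d b` for `a` of degree
`i`, see `tensorD_tmul`. -/
noncomputable def tensorD : TensorCarrier A B →ₗ[ℤ] TensorCarrier A B :=
  AddMonoidHom.toIntLinearMap ((tensorOf A B).toAddMonoidHom.comp
    (((TensorProduct.map A.d LinearMap.id).toAddMonoidHom +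
      (TensorProduct.map A.sign B.d).toAddMonoidHom).comp (tensorTo A B).toAddMonoidHom))

theorem tensorD_tmul {i : ℤ} {a : A} (ha : a ∈ A.gr i) (b : B) :
    tensorD A B (tm a b) = tm (A.d a) b + i.negOnePow • (tm a (B.d b) : TensorCarrier A B) := by
  change tensorOf A B (A.d a ⊗ₜ b + A.sign a ⊗ₜ B.d b) = _
  rw [sign_of_mem A ha, map_add]
  rfl

theorem tensor_leibniz {n : ℤ} {x : TensorCarrier A B} (hx : x ∈ tensorGr A B n)
    (y : TensorCarrier A B) :
    tensorD A B (x * y) = tensorD A B x * y + n.negOnePow • (x * tensorD A B y) := by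
  have hy : y ∈ (⊤ : Submodule ℤ (TensorCarrier A B)) := trivial
  rw [← span_tensor] at hy
  induction hx using Submodule.span_induction with
  | zero => simp only [zero_mul, map_zero, smul_zero, add_zero]
  | add x x' _ _ h h' => rw [add_mul, map_add, h, h', map_add, add_mul, add_mul, smul_add]; abel
  | smul z x _ h =>
    rw [smul_mul_assoc, map_smul, h, map_smul, smul_mul_assoc, smul_mul_assoc, smul_add, smul_comm z]
  | mem x hx =>
    obtain ⟨i, j, rfl, a, ha, b, hb, rfl⟩ := hx
    induction hy using Submodule.span_induction with
    | zero => simp only [mul_zero, map_zero, smul_zero, add_zero]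
    | add x x' _ _ h h' => rw [mul_add, map_add, h, h', map_add, mul_add, mul_add, smul_add]; abel
    | smul z x _ h =>
      rw [mul_smul_comm, map_smul, h, map_smul, mul_smul_comm, mul_smul_comm, smul_add, smul_comm z]
    | mem y hy =>
      obtain ⟨k, l, a', ha', b', hb', rfl⟩ := hy
      have hd : tensorD A B (((j * k).negOnePow : ℤˣ) • (tm (a * a') (b * b') : TensorCarrier A B))
          = ((j * k).negOnePow : ℤˣ) • tensorD A B (tm (a * a') (b * b')) :=
        map_zsmul (tensorD A B) _ _
      rw [tmul_mul_tmul A B a b' hb ha', hd,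
        tensorD_tmul A B (SetLike.GradedMul.mul_mem ha ha'), tensorD_tmul A B ha,
        tensorD_tmul A B ha', A.leibniz i k a a' ha ha', B.leibniz j l b b' hb hb',
        add_mul, mul_add, smul_mul_assoc, mul_smul_comm, tmul_mul_tmul A B _ _ hb ha',
        tmul_mul_tmul A B _ _ (B.d_mem _ _ hb) ha', tmul_mul_tmul A B _ _ hb (A.d_mem _ _ ha'),
        tmul_mul_tmul A B _ _ hb ha']
      have e1 : (tm (A.d a * a' + i.negOnePow • (a * A.d a')) (b * b') : TensorCarrier A B) =
          tm (A.d a * a') (b * b') + i.negOnePow • (tm (a * A.d a') (b * b') : TensorCarrier A B) := by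
        rw [tm_add_left, Units.smul_def, tm_smul_left]; rfl
      have e2 : (tm (a * a') (B.d b * b' + j.negOnePow • (b * B.d b')) : TensorCarrier A B) =
          tm (a * a') (B.d b * b') + j.negOnePow • (tm (a * a') (b * B.d b') : TensorCarrier A B) := by
        rw [tm_add_right, Units.smul_def, tm_smul_right]; rfl
      rw [e1, e2]
      generalize (tm (A.d a * a') (b * b') : TensorCarrier A B) = t1
      generalize (tm (a * A.d a') (b * b') : TensorCarrier A B) = t2
      generalize (tm (a * a') (B.d b * b') : TensorCarrier A B) = t3
      generalize (tm (a * a') (b * B.d b') : TensorCarrier A B) = t4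
      rw [add_mul j 1 k, mul_add j k 1, one_mul, mul_one]
      simp only [Int.negOnePow_add]
      rcases Int.units_eq_one_or i.negOnePow with h1 | h1 <;>
      rcases Int.units_eq_one_or j.negOnePow with h2 | h2 <;>
      rcases Int.units_eq_one_or k.negOnePow with h3 | h3 <;>
      rcases Int.units_eq_one_or (j * k).negOnePow with h4 | h4 <;>
      rw [h1, h2, h3, h4] <;>
      simp only [one_smul, mul_one, mul_neg, neg_neg, Units.neg_smul, smul_add, smul_neg] <;> abel

theorem tensorD_mem {n : ℤ} {x : TensorCarrier A B} (hx : x ∈ tensorGr A B n) :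
    tensorD A B x ∈ tensorGr A B (n + 1) := by
  induction hx using Submodule.span_induction with
  | zero => rw [map_zero]; exact zero_mem _
  | add x x' _ _ h h' => rw [map_add]; exact add_mem h h'
  | smul z x _ h => rw [map_smul]; exact Submodule.smul_mem _ _ h
  | mem x hx =>
    obtain ⟨i, j, rfl, a, ha, b, hb, rfl⟩ := hx
    rw [tensorD_tmul A B ha, Units.smul_def]
    refine add_mem ?_ (Submodule.smul_mem _ _ ?_)
    · rw [add_right_comm]
      exact tmul_mem_tensorGr A B (A.d_mem _ _ ha) hb
    · rw [add_assoc]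
      exact tmul_mem_tensorGr A B ha (B.d_mem _ _ hb)

theorem tensorD_tensorD (x : TensorCarrier A B) : tensorD A B (tensorD A B x) = 0 := by
  have hx : x ∈ (⊤ : Submodule ℤ (TensorCarrier A B)) := trivial
  rw [← span_tensor] at hx
  induction hx using Submodule.span_induction with
  | zero => rw [map_zero, map_zero]
  | add x x' _ _ h h' => rw [map_add, map_add, h, h', add_zero]
  | smul z x _ h => rw [map_smul, map_smul, h, smul_zero]
  | mem x hx =>
    obtain ⟨i, j, a, ha, b, hb, rfl⟩ := hx
    have hd : tensorD A B (i.negOnePow • (tm a (B.d b) : TensorCarrier A B))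
          = i.negOnePow • tensorD A B (tm a (B.d b)) :=
        map_zsmul (tensorD A B) _ _
    rw [tensorD_tmul A B ha, map_add, hd, tensorD_tmul A B (A.d_mem _ _ ha),
      tensorD_tmul A B ha, A.d_d, B.d_d, Int.negOnePow_succ, tm_zero_left, tm_zero_right]
    simp

/-- The DG ring `A ⊗ B`, tensor product over `ℤ`. -/
noncomputable def tensor : DGRng.{u} where
  carrier := TensorCarrier A B
  gr := tensorGr A B
  d := tensorD A B
  d_mem _ _ h := tensorD_mem A B h
  d_d := tensorD_tensorD A B
  leibniz _ _ _ y hx _ := tensor_leibniz A B hx y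

variable {A} in
/-- The map `f ⊗ id`, as an additive map. -/
noncomputable def tensorMapLinear {A' : DGRng.{u}} (f : A ⟶ A') :
    TensorCarrier A B →ₗ[ℤ] TensorCarrier A' B :=
  tensorOf A' B ∘ₗ
    TensorProduct.map f.toRingHom.toAddMonoidHom.toIntLinearMap LinearMap.id ∘ₗ
      tensorTo A B

variable {A} in
theorem tensorMapLinear_tmul {A' : DGRng.{u}} (f : A ⟶ A') (a : A) (b : B) :
    tensorMapLinear B f (tm a b) = tm (f.toRingHom a) b := rfl

variable {A} in
theorem tensorMapLinear_mul {A' : DGRng.{u}} (f : A ⟶ A') (x y : TensorCarrier A B) :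
    tensorMapLinear B f (x * y) = tensorMapLinear B f x * tensorMapLinear B f y := by
  have hx : x ∈ (⊤ : Submodule ℤ (TensorCarrier A B)) := trivial
  have hy : y ∈ (⊤ : Submodule ℤ (TensorCarrier A B)) := trivial
  rw [← span_tensor] at hx hy
  induction hx using Submodule.span_induction with
  | zero => simp only [zero_mul, map_zero]
  | add x x' _ _ h h' => rw [add_mul, map_add, h, h', map_add, add_mul]
  | smul z x _ h => rw [smul_mul_assoc, map_smul, h, map_smul, smul_mul_assoc]
  | mem x hx =>
    obtain ⟨i, j, a, ha, b, hb, rfl⟩ := hx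
    induction hy using Submodule.span_induction with
    | zero => simp only [mul_zero, map_zero]
    | add x x' _ _ h h' => rw [mul_add, map_add, h, h', map_add, mul_add]
    | smul z x _ h => rw [mul_smul_comm, map_smul, h, map_smul, mul_smul_comm]
    | mem y hy =>
      obtain ⟨k, l, a', ha', b', hb', rfl⟩ := hy
      rw [tmul_mul_tmul A B a b' hb ha', tensorMapLinear_tmul, tensorMapLinear_tmul,
        tmul_mul_tmul A' B _ b' hb (f.map_gr _ _ ha'), ← map_mul, ← tensorMapLinear_tmul]
      exact map_zsmul (tensorMapLinear B f) _ _

variable {A} in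
theorem tensorMapLinear_mem {A' : DGRng.{u}} (f : A ⟶ A') {n : ℤ} {x : TensorCarrier A B}
    (hx : x ∈ tensorGr A B n) : tensorMapLinear B f x ∈ tensorGr A' B n := by
  induction hx using Submodule.span_induction with
  | zero => rw [map_zero]; exact zero_mem _
  | add x x' _ _ h h' => rw [map_add]; exact add_mem h h'
  | smul z x _ h => rw [map_smul]; exact Submodule.smul_mem _ _ h
  | mem x hx =>
    obtain ⟨i, j, rfl, a, ha, b, hb, rfl⟩ := hx
    exact tmul_mem_tensorGr A' B (f.map_gr _ _ ha) hb

variable {A} in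
theorem tensorMapLinear_d {A' : DGRng.{u}} (f : A ⟶ A') (x : TensorCarrier A B) :
    tensorMapLinear B f (tensorD A B x) = tensorD A' B (tensorMapLinear B f x) := by
  have hx : x ∈ (⊤ : Submodule ℤ (TensorCarrier A B)) := trivial
  rw [← span_tensor] at hx
  induction hx using Submodule.span_induction with
  | zero => simp only [map_zero]
  | add x x' _ _ h h' => rw [map_add, map_add, h, h', map_add, map_add]
  | smul z x _ h => rw [map_smul, map_smul, h, map_smul, map_smul]
  | mem x hx =>
    obtain ⟨i, j, a, ha, b, hb, rfl⟩ := hx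
    rw [tensorD_tmul A B ha, tensorMapLinear_tmul, tensorD_tmul A' B (f.map_gr _ _ ha), map_add,
      tensorMapLinear_tmul, f.map_d]
    congr 1
    exact map_zsmul (tensorMapLinear B f) _ _

variable {A} in
/-- The DG ring homomorphism `f ⊗ id`. -/
noncomputable def tensorMap {A' : DGRng.{u}} (f : A ⟶ A') : tensor A B ⟶ tensor A' B where
  toRingHom :=
    { toFun := tensorMapLinear B f
      map_zero' := map_zero _
      map_add' := map_add _
      map_one' := by
        change tensorMapLinear B f (tm (1 : A) (1 : B)) = tm (1 : A') (1 : B)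
        rw [tensorMapLinear_tmul, map_one]
      map_mul' := tensorMapLinear_mul B f }
  map_gr _ _ hx := tensorMapLinear_mem B f hx
  map_d x := tensorMapLinear_d B f x

variable {A} in
theorem tensorMapLinear_comp {A' A'' : DGRng.{u}} (f : A ⟶ A') (g : A' ⟶ A'')
    (x : TensorCarrier A B) :
    tensorMapLinear B (f ≫ g) x = tensorMapLinear B g (tensorMapLinear B f x) := by
  have hx : x ∈ (⊤ : Submodule ℤ (TensorCarrier A B)) := trivial
  rw [← span_tensor] at hx
  induction hx using Submodule.span_induction with
  | zero => simp only [map_zero]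
  | add x x' _ _ h h' => rw [map_add, h, h', map_add, map_add]
  | smul z x _ h => rw [map_smul, h, map_smul, map_smul]
  | mem x hx =>
    obtain ⟨i, j, a, ha, b, hb, rfl⟩ := hx
    rfl

theorem tensorMapLinear_id (x : TensorCarrier A B) : tensorMapLinear B (𝟙 A) x = x := by
  have hx : x ∈ (⊤ : Submodule ℤ (TensorCarrier A B)) := trivial
  rw [← span_tensor] at hx
  induction hx using Submodule.span_induction with
  | zero => simp only [map_zero]
  | add x x' _ _ h h' => rw [map_add, h, h']
  | smul z x _ h => rw [map_smul, h]
  | mem x hx =>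
    obtain ⟨i, j, a, ha, b, hb, rfl⟩ := hx
    rfl

/-- The functor `A ↦ A ⊗ B`. -/
noncomputable def tensorRight : DGRng.{u} ⥤ DGRng.{u} where
  obj A := tensor A B
  map f := tensorMap B f
  map_id A := hom_ext fun x => tensorMapLinear_id A B x
  map_comp f g := hom_ext fun x => tensorMapLinear_comp B f g x

end DGRng

/-! ### The DG ring of a simplicial set, and the simplicial cylinder DG ring -/

/-- The cosimplicial ring `{Hom(X_p, ℤ)}` of integer valued functions on a simplicial set `X`, with
pointwise ring structure; it is contravariantly functorial in `X`. -/
def functionRing : SSet.{u}ᵒᵖ ⥤ SimplexCategory ⥤ RingCat.{u} where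
  obj X :=
    { obj := fun p => RingCat.of (X.unop.obj (op p) → ℤ)
      map := fun s => RingCat.ofHom
        (RingHom.pi fun x => Pi.evalRingHom (fun _ => ℤ) (X.unop.map s.op x))
      map_id := fun p => by
        ext c x
        exact congrArg c (ConcreteCategory.congr_hom (X.unop.map_id (op p)) x)
      map_comp := fun s t => by
        ext c x
        exact congrArg c (ConcreteCategory.congr_hom (X.unop.map_comp t.op s.op) x) }
  map φ :=
    { app := fun p => RingCat.ofHom
        (RingHom.pi fun x => Pi.evalRingHom (fun _ => ℤ) (φ.unop.app (op p) x))
      naturality := fun p q s => by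
        ext c x
        exact congrArg c (ConcreteCategory.congr_hom (φ.unop.naturality s.op) x).symm }
  map_id X := rfl
  map_comp φ ψ := rfl

namespace DGRng

/-- The DG ring `N(X, B) = N(X, ℤ) ⊗ B` of a simplicial set `X` and a DG ring `B`, where `N(X, ℤ)` is
the normalization of the cosimplicial ring of integer valued functions on `X`. It is a
contravariant functor of `X`. -/
noncomputable def N (B : DGRng.{u}) : SSet.{u}ᵒᵖ ⥤ DGRng.{u} :=
  functionRing ⋙ normalization ⋙ tensorRight B

/-- The simplicial cylinder DG ring `Cyl(B)`, with `Cyl_q(B) = N(Δ^q, B)`. -/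
noncomputable def cyl (B : DGRng.{u}) : SimplicialObject DGRng.{u} :=
  SSet.stdSimplex.op ⋙ N B

/-- The simplicial set `Hom(A, Cyl(B))`, whose `q`-simplices are the DG ring homomorphisms
`A ⟶ Cyl_q(B)`. -/
noncomputable def homCyl (A B : DGRng.{u}) : SSet.{u} :=
  cyl B ⋙ coyoneda.obj (op A)

end DGRng

namespace DGRng

/-! A horn has only finitely many nondegenerate simplices, and for a simplicial set `X` with this
property `N(X, B)` is the limit of the DG rings `N(Δ^p, B)` over the simplices `Δ^p ⟶ X`. On the
other side, by the Yoneda lemma, a map `X ⟶ Hom(A, Cyl(B))` is a family of morphisms `A ⟶ N(Δ^p, B)`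
indexed by the same simplices and compatible with all maps `Δ^p ⟶ Δ^r` over `X`. The bijection is
therefore the universal property of a limit.

That `N(X, B)` is this limit rests on its description as an abelian group. Normalized cochains
vanish on degenerate simplices, so `N(X, ℤ)` is free on the finitely many indicator cochains, and an
element of `N(X, B)` amounts to an arbitrary `B`-valued function on the nondegenerate simplices
(`eval_ofValues`, `ofValues_eval`). Finiteness matters: in general the map from `N(X, ℤ) ⊗ B` to
such functions is not onto. The value at a simplex `x` is the value at the fundamental simplex of
the restriction along `x` (`eval_eq_eval_topSimplex`). Hence restrictions to simplices are jointly
injective (`ext_simplices`) and compatible families glue (`exists_of_compatible`).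

The multiplication and the differential need no computation: restrictions are DG ring homomorphisms,
so an identity in `N(X, B)` may be tested on simplices. Having degree `i` is also such an identity,
namely equality with the component of degree `i` (`mem_gr_of_simplices`).

For `q = 0` the horn is empty, `N(X, B)` is the zero ring, and both sides have one element. -/

variable {X Y : SSet.{u}} {B : DGRng.{u}}

/-! ### Integral cochains and the basis of indicators -/

/-- The DG ring `N(X, ℤ)`. -/
noncomputable abbrev intCochains (X : SSet.{u}) : DGRng.{u} :=
  normalization.obj (functionRing.obj (op X))

/-- The value of a normalized integral cochain at a simplex. -/
noncomputable def intEval {n : ℕ} (x : X _⦋n⦌) : intCochains X →ₗ[ℤ] ℤ :=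
  AddMonoidHom.toIntLinearMap
    { toFun := fun c => (c.1 n : X _⦋n⦌ → ℤ) x
      map_zero' := rfl
      map_add' := fun _ _ => rfl }

theorem intCochains_ext {c c' : intCochains X}
    (h : ∀ (n : ℕ) (x : X _⦋n⦌), intEval x c = intEval x c') : c = c' :=
  Subtype.ext (funext fun n => funext fun x => h n x)

/-- A degenerate simplex lies in the image of some degeneracy map, and normalized cochains are those
that vanish on these images. In dimension `0` nothing is degenerate. -/
theorem intEval_of_degenerate {n : ℕ} {x : X _⦋n⦌} (hx : x ∈ X.degenerate n)
    (c : intCochains X) : intEval x c = 0 := by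
  cases n with
  | zero => simp at hx
  | succ n =>
    rw [SSet.degenerate_eq_iUnion_range_σ, Set.mem_iUnion] at hx
    obtain ⟨i, y, rfl⟩ := hx
    exact congrFun (c.2.1 n i) y

open Classical in
/-- The normalized integral cochain with value `1` at a given nondegenerate simplex and `0` at all
other simplices. -/
noncomputable def indicator (x : X.N) : intCochains X :=
  ⟨fun _ y => if SSet.S.mk y = x.toS then (1 : ℤ) else 0, by
    refine ⟨fun p i => funext fun y => ?_, x.dim + 1, fun p hp => funext fun y => ?_⟩
    -- Normalization: the degenerate simplex `X.σ i y` cannot be the nondegenerate simplex `x`.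
    -- Presenting `x` by `mk_surjective` makes its dimension a variable, so that the equality of
    -- dimensions can be substituted.
    · refine if_neg fun h => ?_
      obtain ⟨n, ⟨z, hz⟩, rfl⟩ := x.mk_surjective
      obtain rfl : p + 1 = n := congrArg SSet.S.dim h
      rw [SSet.S.ext_iff'] at h
      obtain ⟨_, h⟩ := h
      apply hz
      have h : X.σ i y = z := h
      rw [← h]
      exact X.σ_mem_degenerate i y
    · refine if_neg fun h => ?_
      have : p = x.dim := congrArg SSet.S.dim h
      omega⟩

open Classical in
theorem intEval_indicator (x y : X.N) :
    intEval y.simplex (indicator x) = if y = x then 1 else 0 := by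
  simp only [SSet.N.ext_iff]
  rfl

/-- Both sides vanish at degenerate simplices and agree at nondegenerate ones. So the indicators
generate `N(X, ℤ)`, with the values of `c` as coefficients. -/
theorem sum_indicator [Fintype X.N] (c : intCochains X) :
    ∑ x : X.N, intEval x.simplex c • indicator x = c := by
  classical
  refine intCochains_ext fun n y => ?_
  by_cases hy : y ∈ X.degenerate n
  · rw [intEval_of_degenerate hy, intEval_of_degenerate hy]
  · suffices ∀ z : X.N, intEval z.simplex (∑ x : X.N, intEval x.simplex c • indicator x) =
        intEval z.simplex c from this (SSet.N.mk y hy)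
    intro z
    simp only [map_sum, map_zsmul, intEval_indicator]
    simp

/-! ### Elements of `N(X, B)` as `B`-valued functions on simplices -/

/-- The value at a simplex of an element of `N(X, B)`. -/
noncomputable def eval (B : DGRng.{u}) {n : ℕ} (x : X _⦋n⦌) : (N B).obj (op X) →ₗ[ℤ] B :=
  (TensorProduct.lift ((LinearMap.lsmul ℤ B).comp (intEval x))) ∘ₗ tensorTo (intCochains X) B

variable (B) in
/-- The element `c ⊗ b` of `N(X, B)`. -/
noncomputable def pureCochain (c : intCochains X) (b : B) : (N B).obj (op X) :=
  (tm c b : TensorCarrier (intCochains X) B)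

theorem eval_pureCochain {n : ℕ} (x : X _⦋n⦌) (c : intCochains X) (b : B) :
    eval B x (pureCochain B c b) = intEval x c • b := rfl

theorem pureCochain_sum_left {ι : Type*} (s : Finset ι) (c : ι → intCochains X) (b : B) :
    pureCochain B (∑ i ∈ s, c i) b = ∑ i ∈ s, pureCochain B (c i) b :=
  map_sum (AddMonoidHom.mk' (fun c => pureCochain B c b) fun c c' => tm_add_left _ B c c' b) c s

theorem pureCochain_zero_right (c : intCochains X) : pureCochain B c 0 = 0 :=
  tm_zero_right _ B c

theorem pureCochain_add_right (c : intCochains X) (b b' : B) :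
    pureCochain B c (b + b') = pureCochain B c b + pureCochain B c b' :=
  tm_add_right _ B c b b'

/-- Moves an integer across the tensor sign; in `ofValues_eval` the value `c(x)`, which multiplies
`b`, becomes a coefficient of the indicator of `x`. -/
theorem pureCochain_smul (z : ℤ) (c : intCochains X) (b : B) :
    pureCochain B c (z • b) = pureCochain B (z • c) b :=
  (tm_smul_right _ B z c b).trans (tm_smul_left _ B z c b).symm

@[elab_as_elim]
theorem cochain_induction {P : (N B).obj (op X) → Prop} (t : (N B).obj (op X)) (zero : P 0)
    (pure : ∀ c b, P (pureCochain B c b)) (add : ∀ t t', P t → P t' → P (t + t')) : P t :=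
  TensorProduct.induction_on (motive := fun t => P (tensorOf (intCochains X) B t))
    (tensorTo (intCochains X) B t) (by rw [map_zero]; exact zero) pure
    (fun x y hx hy => by rw [map_add]; exact add _ _ hx hy)

theorem eval_of_degenerate {n : ℕ} {x : X _⦋n⦌} (hx : x ∈ X.degenerate n)
    (t : (N B).obj (op X)) : eval B x t = 0 := by
  induction t using cochain_induction with
  | zero => rw [map_zero]
  | pure c b => rw [eval_pureCochain, intEval_of_degenerate hx, zero_smul]
  | add t t' h h' => rw [map_add, h, h', add_zero]

/-- For `t = c ⊗ b` both sides are `c(φ x) • b`, and both are additive in `t`. -/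
theorem eval_map (φ : X ⟶ Y) {n : ℕ} (x : X _⦋n⦌) (t : (N B).obj (op Y)) :
    eval B x (((N B).map φ.op).toRingHom t) = eval B (φ.app (op ⦋n⦌) x) t := by
  induction t using cochain_induction with
  | zero => simp only [map_zero]
  | pure c b => rfl
  | add t t' h h' => simp only [map_add, h, h']

/-- The element of `N(X, B)` with prescribed values at the nondegenerate simplices of a finite
simplicial set. -/
noncomputable def ofValues [Fintype X.N] (g : X.N → B) : (N B).obj (op X) :=
  ∑ x : X.N, pureCochain B (indicator x) (g x)

theorem eval_ofValues [Fintype X.N] (g : X.N → B) (x : X.N) :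
    eval B x.simplex (ofValues g) = g x := by
  classical
  simp only [ofValues, map_sum, eval_pureCochain, intEval_indicator, ite_smul, one_smul, zero_smul]
  simp

/-- For `t = c ⊗ b` the left side is `∑ x, (c(x) • indicator x) ⊗ b`, and `sum_indicator` collapses
the sum to `c`. With `eval_ofValues` this identifies `N(X, B)` with the functions `X.N → B`. -/
theorem ofValues_eval [Fintype X.N] (t : (N B).obj (op X)) :
    ofValues (fun x : X.N => eval B x.simplex t) = t := by
  induction t using cochain_induction with
  | zero => simp only [ofValues, map_zero, pureCochain_zero_right, Finset.sum_const_zero]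
  | pure c b =>
    simp only [ofValues, eval_pureCochain, pureCochain_smul, ← pureCochain_sum_left, sum_indicator]
  | add t t' h h' =>
    simp only [ofValues, map_add, pureCochain_add_right, Finset.sum_add_distrib] at h h' ⊢
    rw [h, h']

theorem ext_eval [X.Finite] {t t' : (N B).obj (op X)}
    (h : ∀ x : X.N, eval B x.simplex t = eval B x.simplex t') : t = t' := by
  have := Fintype.ofFinite X.N
  rw [← ofValues_eval t, ← ofValues_eval t', funext h]

/-! ### Restriction to simplices and gluing -/

/-- The fundamental simplex of `Δ^n`. -/
def topSimplex (n : ℕ) : (Δ[n] : SSet.{u}) _⦋n⦌ := SSet.yonedaEquiv (𝟙 Δ[n])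

/-- The Yoneda map of `x` sends the fundamental simplex to `x`. This turns values into restrictions.
-/
theorem eval_eq_eval_topSimplex {n : ℕ} (x : X _⦋n⦌) (t : (N B).obj (op X)) :
    eval B x t =
      eval B (topSimplex n) (((N B).map (SSet.yonedaEquiv.symm x).op).toRingHom t) := by
  rw [eval_map, topSimplex, SSet.yonedaEquiv_symm_app_id]

theorem ext_simplices [X.Finite] {t t' : (N B).obj (op X)}
    (h : ∀ (p : ℕ) (x : Δ[p] ⟶ X),
      ((N B).map x.op).toRingHom t = ((N B).map x.op).toRingHom t') : t = t' :=
  ext_eval fun x => by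
    rw [eval_eq_eval_topSimplex x.simplex, eval_eq_eval_topSimplex x.simplex, h]

/-- Elements of the `N(Δ^p, B)` that are compatible along the simplices of a finite simplicial set
`X` come from an element of `N(X, B)`. -/
theorem exists_of_compatible [X.Finite]
    (s : ∀ p : ℕ, ((Δ[p] : SSet.{u}) ⟶ X) → (N B).obj (op Δ[p]))
    (hs : ∀ (p r : ℕ) (θ : (Δ[p] : SSet.{u}) ⟶ Δ[r]) (x : Δ[r] ⟶ X),
      ((N B).map θ.op).toRingHom (s r x) = s p (θ ≫ x)) :
    ∃ t : (N B).obj (op X), ∀ (p : ℕ) (x : Δ[p] ⟶ X), ((N B).map x.op).toRingHom t = s p x := by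
  have := Fintype.ofFinite X.N
  -- The value at `x` is forced by `eval_eq_eval_topSimplex`: it is the value of the prescribed
  -- restriction along `x` at the fundamental simplex.
  let t : (N B).obj (op X) :=
    ofValues fun x => eval B (topSimplex x.dim) (s x.dim (SSet.yonedaEquiv.symm x.simplex))
  -- The formula is needed at degenerate simplices too, since a map `Δ^p ⟶ X` may send a
  -- nondegenerate simplex to a degenerate one.
  have ht (n : ℕ) (z : X _⦋n⦌) :
      eval B z t = eval B (topSimplex n) (s n (SSet.yonedaEquiv.symm z)) := by
    by_cases hz : z ∈ X.degenerate n
    · rw [eval_of_degenerate hz]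
      -- Here `z` is the pullback along `f : [n] ⟶ [m]`, `m < n`, of a simplex `y`. By compatibility
      -- the right side is the value of the element prescribed for `y` at the simplex `f` of `Δ^m`,
      -- which is degenerate.
      obtain ⟨m, hm, f, y, rfl⟩ := hz
      have e : SSet.yonedaEquiv.symm (X.map f.op y) =
          SSet.stdSimplex.map f ≫ SSet.yonedaEquiv.symm y :=
        (SSet.yonedaEquiv_symm_naturality_left f y).symm
      rw [e, ← hs, eval_map, eval_of_degenerate]
      exact ⟨m, hm, f, topSimplex m, rfl⟩
    · exact eval_ofValues _ (SSet.N.mk z hz)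
  refine ⟨t, fun p x => ext_eval fun y => ?_⟩
  -- Both sides become values at the fundamental simplex of a prescribed element, for the simplex
  -- `x(y)` of `X` written once as an image and once as a composition.
  rw [eval_map, ht, eval_eq_eval_topSimplex y.simplex, hs]
  congr 2
  apply SSet.yonedaEquiv.injective
  rw [SSet.yonedaEquiv_comp, Equiv.apply_symm_apply, Equiv.apply_symm_apply]

/-! ### Degrees and gluing of morphisms -/

theorem map_decompose {A A' : DGRng.{u}} (φ : A ⟶ A') (a : A) (i : ℤ) :
    φ.toRingHom (DirectSum.decompose A.gr a i) = DirectSum.decompose A'.gr (φ.toRingHom a) i := by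
  induction a using DirectSum.Decomposition.inductionOn A.gr with
  | zero => simp
  | homogeneous a =>
    rename_i j
    by_cases h : j = i
    · subst h
      rw [DirectSum.decompose_of_mem_same _ a.2,
        DirectSum.decompose_of_mem_same _ (φ.map_gr _ _ a.2)]
    · rw [DirectSum.decompose_of_mem_ne _ a.2 h,
        DirectSum.decompose_of_mem_ne _ (φ.map_gr _ _ a.2) h, map_zero]
  | add a b ha hb => simp [DirectSum.decompose_add, ha, hb]

/-- An element has degree `i` exactly when it equals its component of degree `i`. Taking components
commutes with restriction, so this equation can be tested on simplices. -/
theorem mem_gr_of_simplices [X.Finite] {i : ℤ} {t : (N B).obj (op X)}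
    (h : ∀ (p : ℕ) (x : Δ[p] ⟶ X), ((N B).map x.op).toRingHom t ∈ ((N B).obj (op Δ[p])).gr i) :
    t ∈ ((N B).obj (op X)).gr i := by
  have e : (DirectSum.decompose ((N B).obj (op X)).gr t i : (N B).obj (op X)) = t :=
    ext_simplices fun p x => by
      rw [map_decompose, DirectSum.decompose_of_mem_same _ (h p x)]
  rw [← e]
  exact SetLike.coe_mem _

/-- The morphism to `N(X, B)` given by a compatible family of morphisms to the `N(Δ^p, B)`. -/
theorem exists_hom_of_compatible [X.Finite] {A : DGRng.{u}}
    (s : ∀ p : ℕ, ((Δ[p] : SSet.{u}) ⟶ X) → (A ⟶ (N B).obj (op Δ[p])))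
    (hs : ∀ (p r : ℕ) (θ : (Δ[p] : SSet.{u}) ⟶ Δ[r]) (x : Δ[r] ⟶ X),
      s r x ≫ (N B).map θ.op = s p (θ ≫ x)) :
    ∃ f : A ⟶ (N B).obj (op X), ∀ (p : ℕ) (x : Δ[p] ⟶ X), f ≫ (N B).map x.op = s p x := by
  choose f hf using fun a : A => exists_of_compatible (fun p x => (s p x).toRingHom a)
    fun p r θ x => by rw [← hs, comp_apply]
  refine ⟨{
    toRingHom :=
      -- Each identity holds after restriction along every `x`, where `f` becomes the homomorphism
      -- `s p x`; joint injectivity then gives it in `N(X, B)`.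
      { toFun := f
        map_zero' := ext_simplices fun p x => by simp only [hf, map_zero]
        map_one' := ext_simplices fun p x => by simp only [hf, map_one]
        map_add' := fun a b => ext_simplices fun p x => by simp only [hf, map_add]
        map_mul' := fun a b => ext_simplices fun p x => by simp only [hf, map_mul] }
    map_gr := fun i a ha => mem_gr_of_simplices fun p x => by
      change ((N B).map x.op).toRingHom (f a) ∈ _
      rw [hf]; exact (s p x).map_gr i a ha
    map_d := fun a => ext_simplices fun p x => by
      change ((N B).map x.op).toRingHom (f _) = ((N B).map x.op).toRingHom (_ : (N B).obj (op X))
      rw [hf, Hom.map_d, Hom.map_d]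
      congr 1
      exact (hf a p x).symm }, fun p x => hom_ext fun a => hf a p x⟩

theorem hom_ext_simplices [X.Finite] {A : DGRng.{u}} {f g : A ⟶ (N B).obj (op X)}
    (h : ∀ (p : ℕ) (x : Δ[p] ⟶ X), f ≫ (N B).map x.op = g ≫ (N B).map x.op) : f = g :=
  hom_ext fun a => ext_simplices fun p x => by
    rw [← comp_apply, ← comp_apply, h]

/-! ### The bijection for finite simplicial sets -/

/-- The map `X ⟶ Hom(A, Cyl(B))` given by a morphism `A ⟶ N(X, B)`. -/
noncomputable def toHomCyl {A : DGRng.{u}} (f : A ⟶ (N B).obj (op X)) : X ⟶ homCyl A B where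
  app p := TypeCat.ofHom fun x => f ≫ (N B).map (SSet.yonedaEquiv.symm x).op
  naturality p r θ := by
    ext x
    -- Acting by `θ` on `x` is precomposition with a map of standard simplices; acting on `Hom(A,
    -- Cyl(B))` is postcomposition with the map that `N(-, B)` assigns to it.
    change f ≫ (N B).map (SSet.yonedaEquiv.symm (X.map θ x)).op =
      (f ≫ (N B).map (SSet.yonedaEquiv.symm x).op) ≫ (N B).map (SSet.stdSimplex.map θ.unop).op
    rw [Category.assoc, ← Functor.map_comp, ← op_comp, SSet.yonedaEquiv_symm_naturality_left]
    rfl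

/-- Every map between standard simplices comes from the simplex category, so this is the naturality
of `σ`. -/
theorem homCyl_compatible {A : DGRng.{u}} (σ : X ⟶ homCyl A B) {p r : ℕ}
    (θ : (Δ[p] : SSet.{u}) ⟶ Δ[r]) (x : Δ[r] ⟶ X) :
    (show A ⟶ (N B).obj (op Δ[r]) from σ.app (op ⦋r⦌) (SSet.yonedaEquiv x)) ≫ (N B).map θ.op =
      σ.app (op ⦋p⦌) (SSet.yonedaEquiv (θ ≫ x)) := by
  obtain ⟨f, rfl⟩ := SSet.stdSimplex.map_surjective θ
  rw [← SSet.yonedaEquiv_naturality]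
  exact (ConcreteCategory.congr_hom (σ.naturality f.op) (SSet.yonedaEquiv x)).symm

/-- The morphism `A ⟶ N(X, B)` given by a map `X ⟶ Hom(A, Cyl(B))`. -/
noncomputable def ofHomCyl [X.Finite] {A : DGRng.{u}} (σ : X ⟶ homCyl A B) :
    A ⟶ (N B).obj (op X) :=
  -- The choice is not arbitrary: by `hom_ext_simplices` only one morphism has these restrictions.
  (exists_hom_of_compatible (fun p x => σ.app (op ⦋p⦌) (SSet.yonedaEquiv x))
    fun _ _ θ x => homCyl_compatible σ θ x).choose

theorem ofHomCyl_comp [X.Finite] {A : DGRng.{u}} (σ : X ⟶ homCyl A B) (p : ℕ) (x : Δ[p] ⟶ X) :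
    ofHomCyl σ ≫ (N B).map x.op = σ.app (op ⦋p⦌) (SSet.yonedaEquiv x) :=
  (exists_hom_of_compatible (fun p x => σ.app (op ⦋p⦌) (SSet.yonedaEquiv x))
    fun _ _ θ x => homCyl_compatible σ θ x).choose_spec p x

/-- For a finite simplicial set `X`, maps `X ⟶ Hom(A, Cyl(B))` correspond to morphisms
`A ⟶ N(X, B)`. -/
noncomputable def homCylEquiv (A B : DGRng.{u}) (X : SSet.{u}) [X.Finite] :
    (X ⟶ homCyl A B) ≃ (A ⟶ (N B).obj (op X)) where
  toFun := ofHomCyl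
  invFun := toHomCyl
  left_inv σ := by
    ext ⟨p⟩ x
    induction p using SimplexCategory.rec with | _ p
    refine (ofHomCyl_comp σ p (SSet.yonedaEquiv.symm x)).trans ?_
    rw [Equiv.apply_symm_apply]
    rfl
  right_inv f := hom_ext_simplices fun p x => by
    rw [ofHomCyl_comp]
    change f ≫ (N B).map (SSet.yonedaEquiv.symm (SSet.yonedaEquiv x)).op = _
    rw [Equiv.symm_apply_apply]
end DGRng

/-- For DG rings `A`, `B` and a horn `Λ[q, i]`, the canonical bijection between the maps of simplicial
sets `Λ[q, i] ⟶ Hom(A, Cyl(B))` and the DG ring homomorphisms `A ⟶ N(Λ[q, i], B)`. It is the unique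
bijection `e` such that, for every simplex `x : Δ^p ⟶ Λ[q, i]`, the composition of `e σ` with
`N(x, B) : N(Λ[q, i], B) ⟶ N(Δ^p, B) = Cyl_p(B)` is the `p`-simplex `σ x` of `Hom(A, Cyl(B))`. -/
theorem theorem0p2 (A B : DGRng.{u}) (q : ℕ) (i : Fin (q + 1)) :
    ∃! e : ((Λ[q, i] : SSet.{u}) ⟶ DGRng.homCyl A B) ≃
        (A ⟶ (DGRng.N B).obj (op (Λ[q, i] : SSet.{u}))),
      ∀ (σ : (Λ[q, i] : SSet.{u}) ⟶ DGRng.homCyl A B) (p : ℕ)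
        (x : (Δ[p] : SSet.{u}) ⟶ (Λ[q, i] : SSet.{u})),
        e σ ≫ (DGRng.N B).map x.op = σ.app (op ⦋p⦌) (SSet.yonedaEquiv x) :=
  -- The horn is finite as a subcomplex of `Δ^q`. Uniqueness: the condition fixes all restrictions
  -- of `e σ` to simplices, hence `e σ` itself.
  ⟨DGRng.homCylEquiv A B _, DGRng.ofHomCyl_comp, fun _ he => Equiv.ext fun σ =>
    DGRng.hom_ext_simplices fun p x => (he σ p x).trans (DGRng.ofHomCyl_comp σ p x).symm⟩
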